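/- Let $\mathsf{ZFA}$ be the first-order theory, in the language $\{\in\}$, obtained from $\mathsf{ZFC}$ by replacing the Axiom of Foundation with the Anti-Foundation Axiom: every flat system of equations has a unique solution. Here a flat system is given by disjoint sets $X$ (the indeterminates) and $A$ and a function $x \mapsto S_x$ on $X$ with $S_x \subseteq X \cup A$, and a solution is a function $f$ on $X$ with $f(x) = \{f(y) : y \in S_x \cap X\} \cup (S_x \cap A)$ for all $x \in X$. For an $\{\in\}$-structure $M$, let $S(x,y)$ be the relation $x \in y \lor y \in x$ and $D(x,y)$ the relation $x \in y \land y \in x$. The SD-graph $M_0$ of $M$ is its reduct to $\{S, D\}$ and the D-graph $M_1$ of $M$ is its reduct to $\{D\}$. Let $M \models \mathsf{ZFA}$. Then: 1. there is a countable structure $N \equiv M_0$ which is not isomorphic to the SD-graph of any model of $\mathsf{ZFA}$; 2. there is a countable structure $N' \equiv M_1$ which is not isomorphic to the D-graph of any model of $\mathsf{ZFA}$; 3. the D-graph $M_1$ has a connected component of infinite diameter (the distances between pairs of points of that component are unbounded). -/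

import Mathlib

open scoped FirstOrder

universe u v

namespace AntiFoundation

open FirstOrder FirstOrder.Language

/-! ### The languages `{∈}`, `{S, D}` and `{D}` -/

/-- The relation symbols of the language of set theory: a binary symbol for membership. -/
inductive MemRel : ℕ → Type
  | mem : MemRel 2

/-- The language of set theory, with one binary relation symbol. -/
def LSet : FirstOrder.Language.{0, 0} := ⟨fun _ => Empty, MemRel⟩

/-- The symbol `∈`. -/
abbrev memSym : LSet.Relations 2 := MemRel.mem

/-- The relation symbols of the language with two binary symbols `S` and `D`. -/
inductive SDRel : ℕ → Type
  | S : SDRel 2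
  | D : SDRel 2

/-- The language with two binary relation symbols `S` and `D`. -/
def LSD : FirstOrder.Language.{0, 0} := ⟨fun _ => Empty, SDRel⟩

/-- The relation symbols of the language with one binary symbol `D`. -/
inductive DRel : ℕ → Type
  | D : DRel 2

/-- The language with one binary relation symbol `D`. -/
def LD : FirstOrder.Language.{0, 0} := ⟨fun _ => Empty, DRel⟩

/-- The symbol `D` of the language `{D}`. -/
abbrev dSym : LD.Relations 2 := DRel.D

/-! ### Formulas of set theory

Formulas are written with de Bruijn levels: under `n` quantifiers the variables are the elements
of `Fin n`, a further quantifier binds the variable `Fin.last n`, and the old variables `x` are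
then called `↟x`. -/

/-- Formulas of set theory in the variables `Fin n`. -/
abbrev Fm (n : ℕ) : Type := LSet.BoundedFormula Empty n

local prefix:max "↟" => Fin.castSucc

variable {n : ℕ}

/-- `x ∈ y` -/
def mem (x y : Fin n) : Fm n :=
  memSym.boundedFormula₂ (&x) (&y)

/-- `x = y` -/
def eq (x y : Fin n) : Fm n := (&x) =' (&y)

/-- `x ⊆ y` -/
def subset (x y : Fin n) : Fm n :=
  ∀' (mem (.last _) ↟x ⟹ mem (.last _) ↟y)

/-- `x = ∅` -/
def isEmpty (x : Fin n) : Fm n :=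
  ∀' ∼(mem (.last _) ↟x)

/-- `z = {x, y}` -/
def isPair (z x y : Fin n) : Fm n :=
  ∀' (mem (.last _) ↟z ⇔ (eq (.last _) ↟x ⊔ eq (.last _) ↟y))

/-- `z = x ∪ {x}` -/
def isSucc (z x : Fin n) : Fm n :=
  ∀' (mem (.last _) ↟z ⇔ (mem (.last _) ↟x ⊔ eq (.last _) ↟x))

/-- `z` is the Kuratowski pair `(x, y) = {{x}, {x, y}}`. -/
def isOrderedPair (z x y : Fin n) : Fm n :=
  ∃' ∃' (isPair ↟(.last _) ↟↟x ↟↟x ⊓ isPair (.last _) ↟↟x ↟↟y ⊓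
    isPair ↟↟z ↟(.last _) (.last _))

/-- `(x, y) ∈ f` -/
def pairMem (f x y : Fin n) : Fm n :=
  ∃' (isOrderedPair (.last _) ↟x ↟y ⊓ mem (.last _) ↟f)

/-- `f` is a function with domain `X`. -/
def isFunction (f X : Fin n) : Fm n :=
  (∀' (mem (.last _) ↟f ⟹
    ∃' ∃' (mem ↟(.last _) ↟↟↟X ⊓ isOrderedPair ↟↟(.last _) ↟(.last _) (.last _)))) ⊓
  (∀' (mem (.last _) ↟X ⟹
    ∃' ∀' (pairMem ↟↟↟f ↟↟(.last _) (.last _) ⇔ eq (.last _) ↟(.last _))))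

/-- `X` and `A` are disjoint, and `e` is a flat system of equations with set of indeterminates `X`
and set of constants `A`: it is a function on `X` which assigns to each `x` in `X` the right-hand
side `e(x) ⊆ X ∪ A` of the equation `x = e(x)`. -/
def isFlatSystem (X A e : Fin n) : Fm n :=
  (∀' ∼(mem (.last _) ↟X ⊓ mem (.last _) ↟A)) ⊓ isFunction e X ⊓
  -- for all `x ∈ X` and `s = e(x)`, every `y ∈ s` belongs to `X` or to `A`
  (∀' ∀' (mem ↟(.last _) ↟↟X ⊓ pairMem ↟↟e ↟(.last _) (.last _) ⟹
    ∀' (mem (.last _) ↟(.last _) ⟹ (mem (.last _) ↟↟↟X ⊔ mem (.last _) ↟↟↟A))))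

/-- `f` is a solution of the flat system `e`: it is a function on `X`, and
`f(x) = {f(y) | y ∈ e(x) ∩ X} ∪ (e(x) ∩ A)` for every `x` in `X`. -/
def isSolution (X A e f : Fin n) : Fm n :=
  isFunction f X ⊓
  -- for all `x ∈ X`, `s = e(x)`, `t = f(x)` and all `w`
  (∀' ∀' ∀' (mem ↟↟(.last _) ↟↟↟X ⊓ pairMem ↟↟↟e ↟↟(.last _) ↟(.last _) ⊓
      pairMem ↟↟↟f ↟↟(.last _) (.last _) ⟹
    ∀' (mem (.last _) ↟(.last _) ⇔
      ((∃' (mem (.last _) ↟↟↟(.last _) ⊓ mem (.last _) ↟↟↟↟↟X ⊓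
          pairMem ↟↟↟↟↟f (.last _) ↟(.last _))) ⊔
        (mem (.last _) ↟↟(.last _) ⊓ mem (.last _) ↟↟↟↟A)))))

/-! ### The axioms

In the sentences below the variable bound by the `k`-th nested quantifier, counting from zero,
is the numeral `k`. -/

/-- Sets with the same elements are equal. -/
def extensionality : LSet.Sentence :=
  ∀' ∀' ((∀' (mem (n := 3) 2 0 ⇔ mem 2 1)) ⟹ eq (n := 2) 0 1)

/-- For all `x` and `y` the set `{x, y}` exists. -/
def pairing : LSet.Sentence :=
  ∀' ∀' ∃' (isPair (n := 3) 2 0 1)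

/-- For every `x` the set `⋃ x` exists. -/
def union : LSet.Sentence :=
  ∀' ∃' ∀' (mem (n := 3) 2 1 ⇔ ∃' (mem (n := 4) 2 3 ⊓ mem 3 0))

/-- For every `x` the set of all subsets of `x` exists. -/
def powerSet : LSet.Sentence :=
  ∀' ∃' ∀' (mem (n := 3) 2 1 ⇔ subset 2 0)

/-- There is a set which contains `∅` and is closed under `x ↦ x ∪ {x}`. -/
def infinity : LSet.Sentence :=
  ∃' ((∃' (isEmpty (n := 2) 1 ⊓ mem 1 0)) ⊓
    ∀' (mem (n := 2) 1 0 ⟹ ∃' (isSucc (n := 3) 2 1 ⊓ mem 2 0)))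

/-- Every set of non-empty pairwise disjoint sets has a transversal. -/
def choice : LSet.Sentence :=
  ∀' ((∀' (mem (n := 2) 1 0 ⟹ ∼(isEmpty (n := 2) 1))) ⊓
      (∀' ∀' (mem (n := 3) 1 0 ⊓ mem 2 0 ⊓ (∃' (mem (n := 4) 3 1 ⊓ mem 3 2)) ⟹ eq 1 2)) ⟹
    ∃' ∀' (mem (n := 3) 2 0 ⟹ ∃' ∀' ((mem (n := 5) 4 1 ⊓ mem 4 2) ⇔ eq 4 3)))

/-- The instance of Separation for the formula `φ(p, x)` with parameters `p`:
for all `p` and `a` the set `{x ∈ a | φ(p, x)}` exists. -/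
def separation {k : ℕ} (φ : LSet.Formula (Fin k ⊕ Unit)) : LSet.Sentence :=
  BoundedFormula.alls (n := k) <|
    -- the variables are `p, a, b, x`
    ∀' ∃' ∀' (mem (.last _) ↟(.last _) ⇔
      (mem (.last _) ↟↟(.last _) ⊓
        (BoundedFormula.relabel
          (Sum.elim (fun i => Sum.inr ↟↟↟i) (fun _ => Sum.inr (.last _))) φ : Fm (k + 3))))

/-- The instance of Replacement for the formula `φ(p, x, y)` with parameters `p`, where `x` is
the variable `0` and `y` is the variable `1` of `Fin 2`: for all `p` and `a`, if for each `x ∈ a`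
there is at most one `y` with `φ(p, x, y)`, then the set `{y | ∃ x ∈ a, φ(p, x, y)}` exists. -/
def replacement {k : ℕ} (φ : LSet.Formula (Fin k ⊕ Fin 2)) : LSet.Sentence :=
  BoundedFormula.alls (n := k) <|
    ∀' (
      -- the variables are `p, a, x, y, y'`
      (∀' ∀' ∀' (mem ↟↟(.last _) ↟↟↟(.last _) ⊓
          (BoundedFormula.relabel (Sum.elim (fun i => Sum.inr ↟↟↟↟i)
            ![Sum.inr ↟↟(.last _), Sum.inr ↟(.last _)]) φ : Fm (k + 4)) ⊓
          (BoundedFormula.relabel (Sum.elim (fun i => Sum.inr ↟↟↟↟i)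
            ![Sum.inr ↟↟(.last _), Sum.inr (.last _)]) φ : Fm (k + 4)) ⟹
        eq ↟(.last _) (.last _))) ⟹
      -- the variables are `p, a, b, y, x`
      ∃' ∀' (mem (.last _) ↟(.last _) ⇔
        ∃' (mem (.last _) ↟↟↟(.last _) ⊓
          (BoundedFormula.relabel (Sum.elim (fun i => Sum.inr ↟↟↟↟i)
            ![Sum.inr (.last _), Sum.inr ↟(.last _)]) φ : Fm (k + 4)))))

/-- The Anti-Foundation Axiom: every flat system of equations has a unique solution. -/
def antiFoundation : LSet.Sentence :=
  -- the variables are `X, A, e, f, g`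
  ∀' ∀' ∀' (isFlatSystem (n := 3) 0 1 2 ⟹
    ∃' (isSolution (n := 4) 0 1 2 3 ⊓ ∀' (isSolution (n := 5) 0 1 2 4 ⟹ eq 4 3)))

/-- The axioms of `ZFA`: those of `ZFC` with Foundation replaced by Anti-Foundation. -/
inductive IsAxiom : LSet.Sentence → Prop
  | extensionality : IsAxiom extensionality
  | pairing : IsAxiom pairing
  | union : IsAxiom union
  | powerSet : IsAxiom powerSet
  | infinity : IsAxiom infinity
  | choice : IsAxiom choice
  | separation {k : ℕ} (φ : LSet.Formula (Fin k ⊕ Unit)) : IsAxiom (separation φ)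
  | replacement {k : ℕ} (φ : LSet.Formula (Fin k ⊕ Fin 2)) : IsAxiom (replacement φ)
  | antiFoundation : IsAxiom antiFoundation

/-- The theory `ZFA`, as a set of first-order sentences. -/
def ZFA : LSet.Theory := {φ | IsAxiom φ}

/-! ### Single-double-membership graphs and double-membership graphs -/

/-- `Mem x y` says that `x ∈ y` holds in the structure `M`. -/
def Mem {M : Type u} [LSet.Structure M] (x y : M) : Prop :=
  Structure.RelMap memSym ![x, y]

/-- The domain of the SD-graph of `M`, a copy of `M`. -/
def SDGraph (M : Type u) : Type u := M

/-- The SD-graph of `M`: `S x y` is `x ∈ y ∨ y ∈ x`, and `D x y` is `x ∈ y ∧ y ∈ x`. -/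
instance (M : Type u) [LSet.Structure M] : LSD.Structure (SDGraph M) where
  funMap f := Empty.elim f
  RelMap {_} r := match r with
    | SDRel.S => fun x : Fin 2 → M => Mem (x 0) (x 1) ∨ Mem (x 1) (x 0)
    | SDRel.D => fun x : Fin 2 → M => Mem (x 0) (x 1) ∧ Mem (x 1) (x 0)

/-- The domain of the D-graph of `M`, a copy of `M`. -/
def DGraph (M : Type u) : Type u := M

/-- The D-graph of `M`: `D x y` is `x ∈ y ∧ y ∈ x`. -/
instance (M : Type u) [LSet.Structure M] : LD.Structure (DGraph M) where
  funMap f := Empty.elim f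
  RelMap {_} r := match r with
    | DRel.D => fun x : Fin 2 → M => Mem (x 0) (x 1) ∧ Mem (x 1) (x 0)

/-- The simple graph underlying an `LD`-structure, obtained by forgetting loops (and directions,
if `D` is not symmetric). If `D` is symmetric, it has the same distances and components. -/
def toSimpleGraph (A : Type u) [LD.Structure A] : SimpleGraph A :=
  SimpleGraph.fromRel fun x y => Structure.RelMap dSym ![x, y]

/-- Some connected component of the `LD`-structure `A` has infinite diameter: the distances
between two of its points are not bounded by any natural number. -/
def HasComponentOfInfiniteDiameter (A : Type u) [LD.Structure A] : Prop :=
  ∃ C : (toSimpleGraph A).ConnectedComponent, C.toSimpleGraph.ediam = ⊤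

end AntiFoundation

/-!
Anti-Foundation makes the graphs of a model `M` rich: any digraph on a set of `M` has a *fresh
copy*, which consists of new sets, is a union of components of the D-graph, and whose elements
contain arbitrarily prescribed old sets. Call two tuples `r`-similar if a definable partial
isomorphism of the SD-graph takes one to the other and is defined on the `r`-balls around their
points in the D-graph. If `a` and `b` are `(3r + 1)`-similar and `c` is a further point, then `c` is
either near `a`, and the given isomorphism extends `b` by a point `d`, or `d` can be taken in a
fresh copy of the `r`-ball around `c`, where the copy of `x` contains those points of the balls
around `b` which correspond to `S`-neighbours of `x` in the balls around `a`. In this second case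
the component of `d` has finite diameter. Hence, by back-and-forth, the points whose components have
finite diameter form an elementary substructure of the SD-graph.

A countable elementary submodel of this substructure has only components of finite diameter, whereas
the D-graph of any model has a component which is a ray: the component of the copy of `0` in a
fresh copy of the successor graph of the numerals.
-/

namespace AntiFoundation

open FirstOrder FirstOrder.Language

section Semantics

variable {M : Type u} [LSet.Structure M] {n : ℕ} {e : Empty → M} {v : Fin n → M}

/-- `z = {x, y}` in the structure `M`. -/
def IsPair (z x y : M) : Prop := ∀ w, Mem w z ↔ w = x ∨ w = y

/-- `z = x ∪ {x}` in the structure `M`. -/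
def IsSucc (z x : M) : Prop := ∀ w, Mem w z ↔ Mem w x ∨ w = x

/-- `z` is the Kuratowski pair `(x, y)` in the structure `M`. -/
def IsOrderedPair (z x y : M) : Prop := ∃ s t, IsPair s x x ∧ IsPair t x y ∧ IsPair z s t

/-- `(x, y) ∈ f` in the structure `M`. -/
def PairMem (f x y : M) : Prop := ∃ p, IsOrderedPair p x y ∧ Mem p f

/-- `f` is a function with domain `X` in the structure `M`. -/
def IsFunction (f X : M) : Prop :=
  (∀ p, Mem p f → ∃ x y, Mem x X ∧ IsOrderedPair p x y) ∧
  ∀ x, Mem x X → ∃ y, ∀ z, PairMem f x z ↔ z = y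

theorem realize_mem {x y : Fin n} : (mem x y).Realize e v ↔ Mem (v x) (v y) := by
  simp [mem, Mem, BoundedFormula.realize_rel₂]

theorem realize_eq {x y : Fin n} : (eq x y).Realize e v ↔ v x = v y := by
  simp [eq]

theorem realize_subset {x y : Fin n} :
    (subset x y).Realize e v ↔ ∀ z, Mem z (v x) → Mem z (v y) := by
  simp [subset, realize_mem]

theorem realize_isEmpty {x : Fin n} : (isEmpty x).Realize e v ↔ ∀ z, ¬Mem z (v x) := by
  simp [isEmpty, realize_mem]

theorem realize_isPair {z x y : Fin n} :
    (isPair z x y).Realize e v ↔ IsPair (v z) (v x) (v y) := by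
  simp [isPair, IsPair, realize_mem, realize_eq]

theorem realize_isSucc {z x : Fin n} :
    (isSucc z x).Realize e v ↔ IsSucc (v z) (v x) := by
  simp [isSucc, IsSucc, realize_mem, realize_eq]

theorem realize_isOrderedPair {z x y : Fin n} :
    (isOrderedPair z x y).Realize e v ↔ IsOrderedPair (v z) (v x) (v y) := by
  simp [isOrderedPair, IsOrderedPair, realize_isPair, and_assoc]

theorem realize_pairMem {f x y : Fin n} :
    (pairMem f x y).Realize e v ↔ PairMem (v f) (v x) (v y) := by
  simp [pairMem, PairMem, realize_isOrderedPair, realize_mem]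

theorem realize_isFunction {f X : Fin n} :
    (isFunction f X).Realize e v ↔ IsFunction (v f) (v X) := by
  simp [isFunction, IsFunction, realize_isOrderedPair, realize_mem, realize_pairMem, realize_eq]

theorem realize_isFlatSystem {X A s : Fin n} :
    (isFlatSystem X A s).Realize e v ↔
      (∀ y, ¬(Mem y (v X) ∧ Mem y (v A))) ∧ IsFunction (v s) (v X) ∧
      ∀ x t, Mem x (v X) → PairMem (v s) x t → ∀ y, Mem y t → Mem y (v X) ∨ Mem y (v A) := by
  simp [isFlatSystem, realize_isFunction, realize_mem, realize_pairMem, and_assoc]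

theorem realize_isSolution {X A s f : Fin n} :
    (isSolution X A s f).Realize e v ↔
      IsFunction (v f) (v X) ∧
      ∀ x t y, Mem x (v X) → PairMem (v s) x t → PairMem (v f) x y → ∀ z, Mem z y ↔
        (∃ x', Mem x' t ∧ Mem x' (v X) ∧ PairMem (v f) x' z) ∨ (Mem z t ∧ Mem z (v A)) := by
  simp [isSolution, realize_isFunction, realize_mem, realize_pairMem, and_assoc]

end Semantics

section WeakTheory

/-- Every flat system of equations has a solution: the existence half of the Anti-Foundation
Axiom, known as `AFA₁`. -/
def flatSystemsSolvable : LSet.Sentence :=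
  ∀' ∀' ∀' (isFlatSystem (n := 3) 0 1 2 ⟹ ∃' isSolution (n := 4) 0 1 2 3)

/-- The axioms of Zermelo set theory with Foundation replaced by `AFA₁`. -/
inductive IsZAFA₁Axiom : LSet.Sentence → Prop
  | extensionality : IsZAFA₁Axiom extensionality
  | pairing : IsZAFA₁Axiom pairing
  | union : IsZAFA₁Axiom union
  | powerSet : IsZAFA₁Axiom powerSet
  | infinity : IsZAFA₁Axiom infinity
  | separation {k : ℕ} (φ : LSet.Formula (Fin k ⊕ Unit)) : IsZAFA₁Axiom (separation φ)
  | flatSystemsSolvable : IsZAFA₁Axiom flatSystemsSolvable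

/-- The fragment of `ZFA` in which the graphs are studied: it has neither Choice nor Replacement,
and flat systems need not have unique solutions. -/
def ZAFA₁ : LSet.Theory := {φ | IsZAFA₁Axiom φ}

theorem models_ZAFA₁_of_models_ZFA {M : Type u} [LSet.Structure M] (hM : M ⊨ ZFA) :
    M ⊨ ZAFA₁ := by
  refine ⟨fun φ hφ => ?_⟩
  cases hφ with
  | extensionality => exact hM.realize_of_mem _ .extensionality
  | pairing => exact hM.realize_of_mem _ .pairing
  | union => exact hM.realize_of_mem _ .union
  | powerSet => exact hM.realize_of_mem _ .powerSet
  | infinity => exact hM.realize_of_mem _ .infinity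
  | separation φ => exact hM.realize_of_mem _ (.separation φ)
  | flatSystemsSolvable =>
    have h := hM.realize_of_mem _ IsAxiom.antiFoundation
    simp only [antiFoundation, flatSystemsSolvable, Sentence.Realize, Formula.Realize,
      BoundedFormula.realize_all, BoundedFormula.realize_ex, BoundedFormula.realize_imp,
      BoundedFormula.realize_inf] at h ⊢
    exact fun X A s hs => (h X A s hs).imp fun f hf => hf.1

end WeakTheory

section Definability

variable {M : Type u} [LSet.Structure M] {n : ℕ}

/-- `Set.DefinableFun` with parameters in `M`, as a class, so that definability is found by
instance search. -/
class IsDefinableFun (t : (Fin n → M) → M) : Prop where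
  definableFun : (Set.univ : Set M).DefinableFun LSet t

/-- `Set.Definable` with parameters in `M` for predicates, as a class, so that definability is
found by instance search. -/
class IsDefinable (P : (Fin n → M) → Prop) : Prop where
  definable : (Set.univ : Set M).Definable LSet {v | P v}

/-- `IsDefinable` for classes, that is, for unary predicates. -/
abbrev IsDefinable₁ (P : M → Prop) : Prop := IsDefinable fun v : Fin 1 → M => P (v 0)

/-- `IsDefinable` for binary relations. -/
class IsDefinable₂ (R : M → M → Prop) : Prop where
  isDefinable : IsDefinable fun v : Fin 2 → M => R (v 0) (v 1)

instance IsDefinableFun.var (i : Fin n) : IsDefinableFun fun v : Fin n → M => v i :=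
  ⟨.proj _⟩

instance IsDefinableFun.const (c : M) : IsDefinableFun fun _ : Fin n → M => c :=
  ⟨definableFun_const LSet _ (Set.mem_univ c)⟩

instance IsDefinableFun.comp {m : ℕ} (t : (Fin n → M) → M) (σ : Fin n → Fin m)
    [h : IsDefinableFun t] : IsDefinableFun fun v : Fin m → M => t fun i => v (σ i) :=
  ⟨h.definableFun.comp fun _ => .proj _⟩

namespace IsDefinable

variable (P Q : (Fin n → M) → Prop) (r s t : (Fin n → M) → M) [IsDefinableFun r]
  [hs : IsDefinableFun s] [ht : IsDefinableFun t]

instance comp₂ (R : M → M → Prop) [hR : IsDefinable₂ R] : IsDefinable fun v => R (s v) (t v) := by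
  have h : (Set.univ : Set M).DefinableMap LSet fun v => ![s v, t v] :=
    Fin.forall_fin_two.2 ⟨hs.definableFun, ht.definableFun⟩
  exact ⟨hR.isDefinable.definable.preimage_map h⟩

instance mem : IsDefinable fun v => Mem (s v) (t v) := by
  have : IsDefinable₂ (Mem (M := M)) :=
    ⟨⟨memSym.formula₂ (.var 0) (.var 1) |> (lhomWithConstants LSet _).onFormula, by
      ext v
      simp [Formula.realize_rel₂, Mem]⟩⟩
  infer_instance

instance eq : IsDefinable fun v => s v = t v :=
  ⟨hs.definableFun.ofPred_eq ht.definableFun⟩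

instance false : IsDefinable fun _ : Fin n → M => False :=
  ⟨Set.definable_empty⟩

instance not [hP : IsDefinable P] : IsDefinable fun v => ¬P v :=
  ⟨hP.definable.compl⟩

instance and [hP : IsDefinable P] [hQ : IsDefinable Q] : IsDefinable fun v => P v ∧ Q v :=
  ⟨hP.definable.inter hQ.definable⟩

instance or [hP : IsDefinable P] [hQ : IsDefinable Q] : IsDefinable fun v => P v ∨ Q v :=
  ⟨hP.definable.union hQ.definable⟩

instance imp [IsDefinable P] [IsDefinable Q] : IsDefinable fun v => P v → Q v := by
  simp only [imp_iff_not_or]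
  infer_instance

instance iff [IsDefinable P] [IsDefinable Q] : IsDefinable fun v => P v ↔ Q v := by
  simp only [iff_iff_implies_and_implies]
  infer_instance

instance ex (R : (Fin n → M) → M → Prop)
    [h : IsDefinable fun w : Fin (n + 1) → M => R (fun i => w i.castSucc) (w (Fin.last n))] :
    IsDefinable fun v => ∃ x, R v x := by
  refine ⟨?_⟩
  convert! h.definable.image_comp Fin.castSucc using 1
  ext v
  constructor
  · rintro ⟨x, hx⟩
    exact ⟨Fin.snoc v x, by simpa using hx, by ext; simp⟩
  · rintro ⟨w, hw, rfl⟩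
    exact ⟨_, hw⟩

instance all (R : (Fin n → M) → M → Prop)
    [IsDefinable fun w : Fin (n + 1) → M => R (fun i => w i.castSucc) (w (Fin.last n))] :
    IsDefinable fun v => ∀ x, R v x := by
  simp only [← not_exists_not (p := R _)]
  infer_instance

instance isPair : IsDefinable fun v => IsPair (r v) (s v) (t v) := by
  unfold IsPair; infer_instance

instance isOrderedPair : IsDefinable fun v => IsOrderedPair (r v) (s v) (t v) := by
  unfold IsOrderedPair; infer_instance

instance pairMem : IsDefinable fun v => PairMem (r v) (s v) (t v) := by
  unfold PairMem; infer_instance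

end IsDefinable

/-- Only finitely many parameters occur in a definition, and Separation may quantify over them. -/
theorem IsDefinable₁.exists_formula {P : M → Prop} (h : IsDefinable₁ P) :
    ∃ (k : ℕ) (p : Fin k → M) (φ : LSet.Formula (Fin k ⊕ Unit)),
      ∀ x, φ.Realize (Sum.elim p fun _ => x) ↔ P x := by
  obtain ⟨A, -, hA⟩ := Set.definable_iff_finitely_definable.1 h.definable
  obtain ⟨φ, hφ⟩ := Set.definable_iff_exists_formula_sum.1 hA
  let c := A.equivFin
  refine ⟨_, fun i => (c.symm i).1, φ.relabel (Sum.map c fun _ => ()), fun x => ?_⟩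
  have hx : P x ↔ φ.Realize (Sum.elim (↑) fun _ => x) := (Set.ext_iff.1 hφ fun _ => x)
  rw [hx, Formula.realize_relabel]
  congr! 1
  ext (_ | _) <;> simp [c]

end Definability

section DoubleMembership

variable {M : Type u} [LSet.Structure M]

/-- The relation `x ∈ y ∨ y ∈ x`, written `S` in the language `{S, D}`. -/
def SMem (x y : M) : Prop := Mem x y ∨ Mem y x

/-- The relation `x ∈ y ∧ y ∈ x`, written `D` in the languages `{S, D}` and `{D}`. -/
def DMem (x y : M) : Prop := Mem x y ∧ Mem y x

theorem sMem_comm {x y : M} : SMem x y ↔ SMem y x := or_comm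

theorem dMem_comm {x y : M} : DMem x y ↔ DMem y x := and_comm

instance SMem.isDefinable₂ : IsDefinable₂ (SMem (M := M)) :=
  ⟨by unfold SMem; infer_instance⟩

instance DMem.isDefinable₂ : IsDefinable₂ (DMem (M := M)) :=
  ⟨by unfold DMem; infer_instance⟩

end DoubleMembership

section SmallClasses

variable {M : Type u} [LSet.Structure M]

/-- The class `P` is a set of the structure `M`. -/
def IsSmall (P : M → Prop) : Prop := ∃ a, ∀ x, Mem x a ↔ P x

theorem isSmall_mem (a : M) : IsSmall fun x => Mem x a := ⟨a, fun _ => Iff.rfl⟩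

variable [hM : M ⊨ ZAFA₁]

theorem eq_of_forall_mem_iff {x y : M} (h : ∀ z, Mem z x ↔ Mem z y) : x = y := by
  have hext := hM.realize_of_mem _ IsZAFA₁Axiom.extensionality
  simp only [extensionality, Sentence.Realize, Formula.Realize, BoundedFormula.realize_all,
    BoundedFormula.realize_imp, BoundedFormula.realize_iff, realize_mem, realize_eq] at hext
  exact hext x y h

theorem isSmall_eq_or_eq (x y : M) : IsSmall fun z => z = x ∨ z = y := by
  have h := hM.realize_of_mem _ IsZAFA₁Axiom.pairing
  simp only [pairing, Sentence.Realize, Formula.Realize, BoundedFormula.realize_all,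
    BoundedFormula.realize_ex, realize_isPair] at h
  exact h x y

theorem isSmall_eq (x : M) : IsSmall fun z => z = x := by
  simpa only [or_self] using isSmall_eq_or_eq x x

theorem exists_inductive : ∃ I : M, (∃ e, (∀ z, ¬Mem z e) ∧ Mem e I) ∧
    ∀ x, Mem x I → ∃ y, IsSucc y x ∧ Mem y I := by
  have h := hM.realize_of_mem _ IsZAFA₁Axiom.infinity
  simp only [infinity, Sentence.Realize, Formula.Realize, BoundedFormula.realize_all,
    BoundedFormula.realize_ex, BoundedFormula.realize_imp, BoundedFormula.realize_inf, realize_mem,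
    realize_isEmpty, realize_isSucc] at h
  exact h

namespace IsSmall

variable {P Q : M → Prop}

theorem sUnion (hP : IsSmall P) : IsSmall fun z => ∃ y, Mem z y ∧ P y := by
  have h := hM.realize_of_mem _ IsZAFA₁Axiom.union
  simp only [AntiFoundation.union, Sentence.Realize, Formula.Realize, BoundedFormula.realize_all,
    BoundedFormula.realize_ex, BoundedFormula.realize_iff, BoundedFormula.realize_inf,
    realize_mem] at h
  obtain ⟨a, ha⟩ := hP
  simp only [← ha]
  exact h a

theorem powerset (hP : IsSmall P) : IsSmall fun z => ∀ y, Mem y z → P y := by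
  have h := hM.realize_of_mem _ IsZAFA₁Axiom.powerSet
  simp only [powerSet, Sentence.Realize, Formula.Realize, BoundedFormula.realize_all,
    BoundedFormula.realize_ex, BoundedFormula.realize_iff, realize_mem, realize_subset] at h
  obtain ⟨a, ha⟩ := hP
  simp only [← ha]
  exact h a

theorem or (hP : IsSmall P) (hQ : IsSmall Q) : IsSmall fun z => P z ∨ Q z := by
  obtain ⟨a, ha⟩ := hP
  obtain ⟨b, hb⟩ := hQ
  simpa only [and_or_left, exists_or, exists_eq_right, ha, hb] using (isSmall_eq_or_eq a b).sUnion

theorem and_left [hQ : IsDefinable₁ Q] (hP : IsSmall P) : IsSmall fun x => P x ∧ Q x := by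
  obtain ⟨k, p, φ, hφ⟩ := hQ.exists_formula
  obtain ⟨a, ha⟩ := hP
  have h := hM.realize_of_mem _ (IsZAFA₁Axiom.separation φ)
  simp only [separation, Sentence.Realize, BoundedFormula.realize_alls, BoundedFormula.realize_all,
    BoundedFormula.realize_ex, BoundedFormula.realize_iff, BoundedFormula.realize_inf, realize_mem,
    Fin.snoc_castSucc, Fin.snoc_last, BoundedFormula.realize_relabel] at h
  obtain ⟨b, hb⟩ := h p a
  refine ⟨b, fun x => (hb x).trans (and_congr (ha x) ((Eq.to_iff ?_).trans (hφ x)))⟩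
  refine congrArg₂ (BoundedFormula.Realize φ) (funext fun i => ?_) (Subsingleton.elim _ _)
  rcases i with i | _
  · change Fin.snoc (α := fun _ => M) (Fin.snoc (Fin.snoc p a) b) x
      i.castSucc.castSucc.castSucc = p i
    simp only [Fin.snoc_castSucc]
  · exact Fin.snoc_last (α := fun _ => M) ..

theorem mono [IsDefinable₁ P] (hQ : IsSmall Q) (h : ∀ x, P x → Q x) : IsSmall P := by
  simpa only [and_iff_right_of_imp (h _)] using hQ.and_left (Q := P)

theorem finite_ex {ι : Type*} [Finite ι] {P : ι → M → Prop} (h : ∀ i, IsSmall (P i)) :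
    IsSmall fun x => ∃ i, P i x := by
  induction ι using Finite.induction_empty_option with
  | of_equiv e ih => simpa only [e.surjective.exists] using ih fun i => h (e i)
  | h_empty =>
    obtain ⟨-, ⟨e, he, -⟩, -⟩ := exists_inductive (M := M)
    exact ⟨e, fun x => by simp [he]⟩
  | h_option ih => simpa only [Option.exists] using (h none).or (ih fun i => h (some i))

/-- Russell's argument: the set of all isolated elements of `P` is isolated. -/
theorem exists_isolated (hP : IsSmall P) : ∃ w, ¬P w ∧ ∀ z, ¬DMem w z := by
  obtain ⟨w, hw⟩ := hP.and_left (Q := fun z : M => ∀ t : M, ¬DMem z t)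
  have hisol : ∀ z, ¬DMem w z := fun z hz => ((hw z).1 hz.2).2 w (dMem_comm.1 hz)
  have hww : ¬Mem w w := fun h => hisol w ⟨h, h⟩
  exact ⟨w, fun hPw => hww ((hw w).2 ⟨hPw, hisol⟩), hisol⟩

end IsSmall

end SmallClasses

section Pairs

variable {M : Type u} [LSet.Structure M] [hM : M ⊨ ZAFA₁]

/-- The unordered pair `{x, y}`. -/
noncomputable def pair (x y : M) : M := (isSmall_eq_or_eq x y).choose

theorem mem_pair {x y z : M} : Mem z (pair x y) ↔ z = x ∨ z = y :=
  (isSmall_eq_or_eq x y).choose_spec z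

theorem isPair_iff {x y z : M} : IsPair z x y ↔ z = pair x y :=
  ⟨fun h => eq_of_forall_mem_iff fun w => (h w).trans mem_pair.symm, fun h _ => h ▸ mem_pair⟩

theorem pair_eq_pair_iff {x y x' y' : M} :
    pair x y = pair x' y' ↔ x = x' ∧ y = y' ∨ x = y' ∧ y = x' := by
  refine ⟨fun h => ?_, ?_⟩
  · have hmem : ∀ z, (z = x ∨ z = y) ↔ (z = x' ∨ z = y') := fun z => by rw [← mem_pair, h, mem_pair]
    have hx := hmem x
    have hy := hmem y
    have hx' := hmem x'
    have hy' := hmem y'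
    grind
  · rintro (⟨rfl, rfl⟩ | ⟨rfl, rfl⟩)
    · rfl
    · exact eq_of_forall_mem_iff fun z => by simp only [mem_pair, or_comm]

theorem pair_right_injective (w : M) : Function.Injective (pair w) := fun x y h => by
  rcases pair_eq_pair_iff.1 h with h | h
  · exact h.2
  · exact h.2.trans h.1

instance IsDefinableFun.pair {n : ℕ} (s t : (Fin n → M) → M) [hs : IsDefinableFun s]
    [ht : IsDefinableFun t] : IsDefinableFun fun v => pair (s v) (t v) := by
  have hisPair : IsDefinable fun v : Fin 3 → M => IsPair (v 2) (v 0) (v 1) := inferInstance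
  have hgraph : (Function.tupleGraph fun v : Fin 2 → M => AntiFoundation.pair (v 0) (v 1)) =
      (· ∘ ![some 0, some 1, none]) ⁻¹' {v : Fin 3 → M | IsPair (v 2) (v 0) (v 1)} := by
    ext v
    simp [Function.tupleGraph, isPair_iff, eq_comm]
  have hpair : (Set.univ : Set M).DefinableFun LSet
      fun v : Fin 2 → M => AntiFoundation.pair (v 0) (v 1) := by
    rw [Set.DefinableFun, hgraph]
    exact hisPair.definable.preimage_comp _
  have hst : (Set.univ : Set M).DefinableMap LSet fun v => ![s v, t v] :=
    Fin.forall_fin_two.2 ⟨hs.definableFun, ht.definableFun⟩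
  exact ⟨.comp hst hpair⟩

/-- The Kuratowski pair `(x, y) = {{x}, {x, y}}`. -/
noncomputable def orderedPair (x y : M) : M := pair (pair x x) (pair x y)

theorem isOrderedPair_iff {x y z : M} : IsOrderedPair z x y ↔ z = orderedPair x y := by
  simp [IsOrderedPair, isPair_iff, orderedPair]

theorem pairMem_iff {f x y : M} : PairMem f x y ↔ Mem (orderedPair x y) f := by
  simp [PairMem, isOrderedPair_iff]

theorem orderedPair_inj {x y x' y' : M} :
    orderedPair x y = orderedPair x' y' ↔ x = x' ∧ y = y' := by
  simp only [orderedPair, pair_eq_pair_iff]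
  grind

instance IsDefinableFun.orderedPair {n : ℕ} (s t : (Fin n → M) → M) [IsDefinableFun s]
    [IsDefinableFun t] : IsDefinableFun fun v => orderedPair (s v) (t v) := by
  unfold AntiFoundation.orderedPair; infer_instance

end Pairs

section FlatSystems

variable {M : Type u} [LSet.Structure M] [hM : M ⊨ ZAFA₁]

theorem exists_isFunction {X V : M} (R : M → M → Prop) [IsDefinable₂ R]
    (hR : ∀ x, Mem x X → ∃ y, Mem y V ∧ ∀ z, R x z ↔ z = y) :
    ∃ s, IsFunction s X ∧ ∀ x, Mem x X → ∀ y, PairMem s x y ↔ R x y := by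
  have hsmall : IsSmall fun p => ∃ x y, Mem x X ∧ R x y ∧ p = orderedPair x y := by
    refine ((isSmall_mem X).or (isSmall_mem V)).powerset.powerset.mono ?_
    rintro _ ⟨x, y, hx, hxy, rfl⟩ s hs z hz
    obtain ⟨y', hy', h⟩ := hR x hx
    obtain rfl := (h y).1 hxy
    rcases mem_pair.1 hs with rfl | rfl <;> rcases mem_pair.1 hz with rfl | rfl <;> tauto
  obtain ⟨s, hs⟩ := hsmall
  have hpair : ∀ x, Mem x X → ∀ y, PairMem s x y ↔ R x y := fun x hx y => by
    simp only [pairMem_iff, hs, orderedPair_inj]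
    exact ⟨fun ⟨_, _, _, h, hx, hy⟩ => hx ▸ hy ▸ h, fun h => ⟨x, y, hx, h, rfl, rfl⟩⟩
  refine ⟨s, ⟨fun p hp => ?_, fun x hx => ?_⟩, hpair⟩
  · obtain ⟨x, y, hx, -, rfl⟩ := (hs p).1 hp
    exact ⟨x, y, hx, isOrderedPair_iff.2 rfl⟩
  · obtain ⟨y, -, hy⟩ := hR x hx
    exact ⟨y, fun z => (hpair x hx z).trans (hy z)⟩

theorem exists_solution_of_isFlatSystem {X A s : M} (hXA : ∀ y, ¬(Mem y X ∧ Mem y A))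
    (hs : IsFunction s X)
    (hsXA : ∀ x t, Mem x X → PairMem s x t → ∀ y, Mem y t → Mem y X ∨ Mem y A) :
    ∃ f, IsFunction f X ∧
      ∀ x t y, Mem x X → PairMem s x t → PairMem f x y → ∀ z, Mem z y ↔
        (∃ x', Mem x' t ∧ Mem x' X ∧ PairMem f x' z) ∨ (Mem z t ∧ Mem z A) := by
  have h := hM.realize_of_mem _ IsZAFA₁Axiom.flatSystemsSolvable
  simp only [flatSystemsSolvable, Sentence.Realize, Formula.Realize, BoundedFormula.realize_all,
    BoundedFormula.realize_ex, BoundedFormula.realize_imp, realize_isFlatSystem,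
    realize_isSolution] at h
  exact h X A s ⟨hXA, hs, hsXA⟩

/-- The graph of the restriction of `F` to `X`. -/
def GraphOn (X : M) (F : M → M) (x y : M) : Prop := Mem x X ∧ y = F x

/-- `F` is a definable solution of the system of equations
`F x = {F x' | x' ∈ X, E x' x} ∪ {z ∈ T | Q z x}` for `x ∈ X`. -/
structure IsSolution (X T : M) (E Q : M → M → Prop) (F : M → M) : Prop where
  isDefinable₂ : IsDefinable₂ (GraphOn X F)
  mem_iff : ∀ x, Mem x X → ∀ z,
    Mem z (F x) ↔ (∃ x', Mem x' X ∧ E x' x ∧ z = F x') ∨ (Mem z T ∧ Q z x)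

variable (X T : M) (E Q : M → M → Prop) [IsDefinable₂ E] [IsDefinable₂ Q]

theorem exists_isSolution_of_disjoint (hXT : ∀ y, ¬(Mem y X ∧ Mem y T)) :
    ∃ F, IsSolution X T E Q F := by
  have hsmall : ∀ x, IsSmall fun z => (Mem z X ∧ E z x) ∨ (Mem z T ∧ Q z x) := fun x =>
    (isSmall_mem X).and_left.or (isSmall_mem T).and_left
  choose S hS using hsmall
  obtain ⟨V, hV⟩ := ((isSmall_mem X).or (isSmall_mem T)).powerset
  have : IsDefinable₂ fun x t => ∀ z, Mem z t ↔ (Mem z X ∧ E z x) ∨ (Mem z T ∧ Q z x) :=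
    ⟨inferInstance⟩
  obtain ⟨s, hs, hsS⟩ := exists_isFunction (X := X) (V := V)
    (fun x t => ∀ z, Mem z t ↔ (Mem z X ∧ E z x) ∨ (Mem z T ∧ Q z x)) fun x _ => ⟨S x,
      (hV _).2 fun z hz => ((hS x z).1 hz).imp And.left And.left, fun t =>
      ⟨fun h => eq_of_forall_mem_iff fun z => (h z).trans (hS x z).symm, fun h => h ▸ hS x⟩⟩
  obtain ⟨f, hf, hfs⟩ := exists_solution_of_isFlatSystem hXT hs fun x t hx ht y hy =>
    (((hsS x hx t).1 ht y).1 hy).imp And.left And.left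
  choose! F hF using hf.2
  refine ⟨F, ⟨?_⟩, fun x hx z => ?_⟩
  · have : ∀ x y, GraphOn X F x y ↔ Mem x X ∧ PairMem f x y := fun x y =>
      and_congr_right fun hx => (hF x hx y).symm
    simp only [this]
    infer_instance
  · rw [hfs x (S x) (F x) hx ((hsS x hx _).2 (hS x)) ((hF x hx _).2 rfl)]
    simp only [hS]
    constructor
    · rintro (⟨x', h, hx', hz⟩ | h)
      · have := hXT x'
        exact .inl ⟨x', hx', by tauto, (hF x' hx' z).1 hz⟩
      · have := hXT z
        tauto
    · rintro (⟨x', hx', hE, hz⟩ | h)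
      · exact .inl ⟨x', .inl ⟨hx', hE⟩, hx', (hF x' hx' z).2 hz⟩
      · tauto

/-- The elements `x` of `X` are coded by pairs `{v, x}` in order to make `X` disjoint from `T`. -/
theorem exists_isSolution : ∃ F, IsSolution X T E Q F := by
  obtain ⟨v, hv, -⟩ := (isSmall_mem T).sUnion.exists_isolated
  have hsmall : IsSmall fun z => ∃ x, Mem x X ∧ pair v x = z := by
    refine ((isSmall_eq v).or (isSmall_mem X)).powerset.mono ?_
    rintro _ ⟨x, hx, rfl⟩ y hy
    rcases mem_pair.1 hy with rfl | rfl <;> tauto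
  obtain ⟨X', hX'⟩ := hsmall
  have : IsDefinable₂ fun a b => ∃ x y, a = pair v x ∧ b = pair v y ∧ E x y := ⟨inferInstance⟩
  have : IsDefinable₂ fun z b => ∃ x, b = pair v x ∧ Q z x := ⟨inferInstance⟩
  obtain ⟨F, hFdef, hF⟩ := exists_isSolution_of_disjoint X' T
    (fun a b => ∃ x y, a = pair v x ∧ b = pair v y ∧ E x y) (fun z b => ∃ x, b = pair v x ∧ Q z x)
    fun z hz => by
      obtain ⟨x, -, rfl⟩ := (hX' z).1 hz.1
      exact hv ⟨_, mem_pair.2 (.inl rfl), hz.2⟩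
  have hmem : ∀ x, Mem (pair v x) X' ↔ Mem x X := fun x => by
    simp [hX', (pair_right_injective v).eq_iff]
  refine ⟨fun x => F (pair v x), ⟨?_⟩, fun x hx z => ?_⟩
  · have : ∀ x y, GraphOn X (fun x => F (pair v x)) x y ↔ ∃ a, a = pair v x ∧ GraphOn X' F a y := by
      simp [GraphOn, hmem]
    simp only [this]
    infer_instance
  · rw [hF _ ((hmem x).2 hx)]
    simp [hX', (pair_right_injective v).eq_iff]

theorem exists_solution_with_tags (w : M) : ∃ F, IsDefinable₂ (GraphOn X F) ∧
    ∀ x, Mem x X → ∀ z, Mem z (F x) ↔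
      (∃ x', Mem x' X ∧ E x' x ∧ z = F x') ∨ (Mem z T ∧ Q z x) ∨ z = w ∨ z = pair w x := by
  have hsmall : IsSmall fun z => Mem z T ∨ z = w ∨ ∃ x, Mem x X ∧ pair w x = z := by
    refine (isSmall_mem T).or ((isSmall_eq w).or ?_)
    refine ((isSmall_eq w).or (isSmall_mem X)).powerset.mono ?_
    rintro _ ⟨x, hx, rfl⟩ y hy
    rcases mem_pair.1 hy with rfl | rfl <;> tauto
  obtain ⟨T', hT'⟩ := hsmall
  have : IsDefinable₂ fun z x => (Mem z T ∧ Q z x) ∨ z = w ∨ z = pair w x := ⟨inferInstance⟩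
  obtain ⟨F, hFdef, hF⟩ := exists_isSolution X T' E
    fun z x => (Mem z T ∧ Q z x) ∨ z = w ∨ z = pair w x
  refine ⟨F, hFdef, fun x hx z => (hF x hx z).trans (or_congr_right (and_iff_right_of_imp ?_))⟩
  rw [hT']
  exact Or.imp And.left (Or.imp_right fun h => ⟨x, hx, h.symm⟩)

/-- `F` maps the digraph `E` on `X` to an isomorphic copy of it, consisting of sets which are
unrelated to the elements of `T`, except that `t ∈ F x` when `Q t x`. The copy is a union of
components of the double-membership graph. -/
structure IsFreshCopy (X T : M) (E Q : M → M → Prop) (F : M → M) : Prop where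
  isDefinable₂ : IsDefinable₂ (GraphOn X F)
  notMem {x} : Mem x X → ¬Mem (F x) T
  notMem_of_mem {x t} : Mem x X → Mem t T → ¬Mem (F x) t
  injOn {x x'} : Mem x X → Mem x' X → F x = F x' → x = x'
  mem_iff {x x'} : Mem x X → Mem x' X → (Mem (F x) (F x') ↔ E x x')
  mem_iff_of_mem {x t} : Mem x X → Mem t T → (Mem t (F x) ↔ Q t x)
  exists_eq_of_dMem {x z} : Mem x X → DMem (F x) z → ∃ y, Mem y X ∧ z = F y

/-- Tagging `F x` with new elements `w` and `{w, x}` makes `F` injective and its values new. -/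
theorem exists_isFreshCopy : ∃ F, IsFreshCopy X T E Q F := by
  have hU := (isSmall_mem T).or ((isSmall_mem T).sUnion.or (isSmall_mem X))
  obtain ⟨w, hw, hisol⟩ := (hU.or hU.sUnion).exists_isolated
  simp only [not_or, not_exists, not_and] at hw
  obtain ⟨⟨hwT, hwTU, -⟩, hwU⟩ := hw
  obtain ⟨F, hFdef, hF⟩ := exists_solution_with_tags X T E Q w
  have hwp (x) : Mem w (pair w x) := mem_pair.2 (.inl rfl)
  have hpT (x) : ¬Mem (pair w x) T := hwTU _ (hwp x)
  have hww : ¬Mem w w := fun h => hisol w ⟨h, h⟩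
  have hpw (x) : pair w x ≠ w := fun h => hww (h.subst (motive := Mem w) (hwp x))
  have hwF {x} (hx : Mem x X) : Mem w (F x) := (hF x hx w).2 (by simp)
  have hpF {x} (hx : Mem x X) : Mem (pair w x) (F x) := (hF x hx _).2 (by simp)
  have hFU {x} (hx : Mem x X) := hwU (F x) (hwF hx)
  have hFw {x} (hx : Mem x X) (h : F x = w) : False :=
    hww (h.subst (motive := Mem w) (hwF hx))
  have hFp {x x'} (hx : Mem x X) (hx' : Mem x' X) (h : F x = pair w x') : False := by
    rcases mem_pair.1 (h ▸ hpF hx) with h | h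
    · exact hpw x h
    · exact (hwU x' (h ▸ hwp x)).2.2 hx'
  have hinj {x x'} (hx : Mem x X) (hx' : Mem x' X) (h : F x = F x') : x = x' := by
    rcases (hF x' hx' _).1 (h ▸ hpF hx) with ⟨y, hy, -, h⟩ | h | h | h
    exacts [(hFp hy hx h.symm).elim, (hpT x h.1).elim, (hpw x h).elim, pair_right_injective w h]
  refine ⟨F, hFdef, fun hx => (hFU hx).1, fun hx ht h => (hFU hx).2.1 _ h ht, hinj,
    fun {x x'} hx hx' => (hF x' hx' _).trans ⟨?_, fun h => .inl ⟨x, hx, h, rfl⟩⟩,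
    fun {x t} hx ht => (hF x hx t).trans ⟨?_, fun h => .inr (.inl ⟨ht, h⟩)⟩,
    fun {x z} hx hz => ?_⟩
  · rintro (⟨y, hy, hE, h⟩ | h | h | h)
    exacts [hinj hx hy h ▸ hE, absurd h.1 (hFU hx).1, (hFw hx h).elim, (hFp hx hx' h).elim]
  · rintro (⟨y, hy, -, rfl⟩ | h | rfl | rfl)
    exacts [absurd ht (hFU hy).1, h.2, absurd ht hwT, absurd ht (hpT x)]
  · rcases (hF x hx z).1 hz.2 with ⟨y, hy, -, rfl⟩ | h | rfl | rfl
    · exact ⟨y, hy, rfl⟩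
    · exact absurd h.1 ((hFU hx).2.1 z hz.1)
    · exact absurd (dMem_comm.1 hz) (hisol _)
    · rcases mem_pair.1 hz.1 with h | h
      · exact (hFw hx h).elim
      · exact absurd (h.symm.subst (motive := (Mem · X)) hx) (hFU hx).2.2

end FlatSystems

section Distance

variable {α : Type*} {G : SimpleGraph α} {r s : ℕ} {x y z : α}

/-- The point `y` lies in the closed ball of radius `r` about `x` in the graph `G`. -/
def Near (G : SimpleGraph α) (r : ℕ) (x y : α) : Prop := G.edist x y ≤ r

@[simp]
theorem near_zero : Near G 0 x y ↔ x = y := by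
  simp [Near]

theorem Near.refl (r : ℕ) (x : α) : Near G r x x := by
  simp [Near]

theorem Near.symm (h : Near G r x y) : Near G r y x := by
  rwa [Near, SimpleGraph.edist_comm]

theorem Near.mono (h : Near G r x y) (hrs : r ≤ s) : Near G s x y :=
  le_trans h (by exact_mod_cast hrs)

theorem Near.trans (h : Near G r x y) (h' : Near G s y z) : Near G (r + s) x z := by
  unfold Near
  push_cast
  exact G.edist_triangle.trans (add_le_add h h')

theorem near_of_walk (p : G.Walk x y) : Near G p.length x y := SimpleGraph.edist_le p

theorem Near.reachable (h : Near G r x y) : G.Reachable x y :=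
  SimpleGraph.reachable_of_edist_ne_top (ne_top_of_le_ne_top (ENat.natCast_ne_top r) h)

theorem near_one : Near G 1 x y ↔ x = y ∨ G.Adj x y := by
  rw [Near, Nat.cast_one, SimpleGraph.edist_le_one_iff_adj_or_eq, or_comm]

theorem near_succ : Near G (r + 1) x y ↔ ∃ z, Near G r x z ∧ (z = y ∨ G.Adj z y) := by
  refine ⟨fun h => ?_, fun ⟨z, hz, hzy⟩ => hz.trans (near_one.2 hzy)⟩
  obtain ⟨p, hp⟩ := h.reachable.exists_walk_length_eq_edist
  have hle : p.reverse.length ≤ r + 1 := by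
    rw [Near, ← hp] at h
    rw [SimpleGraph.Walk.length_reverse]
    exact_mod_cast h
  generalize p.reverse = q at hle
  cases q with
  | nil => exact ⟨x, .refl r x, .inl rfl⟩
  | cons hyz q =>
    refine ⟨_, (near_of_walk q).symm.mono ?_, .inr hyz.symm⟩
    rwa [SimpleGraph.Walk.length_cons, add_le_add_iff_right] at hle

/-- The points of the component of `x` have distance at most `r` from `x`. -/
def EccentLE (G : SimpleGraph α) (r : ℕ) (x : α) : Prop := ∀ y, G.Reachable x y → Near G r x y

theorem eccentLE_iff : EccentLE G r x ↔ ∀ y, Near G (r + 1) x y → Near G r x y := by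
  refine ⟨fun h y hy => h y hy.reachable, fun h y hy => ?_⟩
  have key : ∀ s y, Near G s x y → Near G r x y := fun s => by
    induction s with
    | zero => exact fun y hy => hy.mono r.zero_le
    | succ s ih =>
      intro y hy
      obtain ⟨z, hz, hzy⟩ := near_succ.1 hy
      exact h y (near_succ.2 ⟨z, ih z hz, hzy⟩)
  exact hy.elim fun p => key _ y (near_of_walk p)

theorem EccentLE.of_near (h : EccentLE G r x) (hxy : Near G s x y) : EccentLE G (s + r) y :=
  fun z hz => hxy.symm.trans (h z (hxy.reachable.trans hz))

theorem ediam_toSimpleGraph_eq_top (hx : ∀ r, ¬EccentLE G r x) :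
    (G.connectedComponentMk x).toSimpleGraph.ediam = ⊤ := by
  refine SimpleGraph.ediam_eq_top.2 fun k hk => ?_
  lift k to ℕ using hk.ne
  have hxk := hx k
  simp only [EccentLE, not_forall] at hxk
  obtain ⟨y, hxy, hfar⟩ := hxk
  refine ⟨⟨x, rfl⟩, ⟨y, SimpleGraph.ConnectedComponent.sound hxy.symm⟩, not_le.1 fun hle => hfar ?_⟩
  obtain ⟨p, hp⟩ := (Near.reachable hle).exists_walk_length_eq_edist
  refine (near_of_walk (p.map (G.connectedComponentMk x).toSimpleGraph_hom)).mono ?_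
  rw [SimpleGraph.Walk.length_map]
  rw [← hp] at hle
  exact_mod_cast hle

/-- The formula which says that `y` has distance at most `r` from `x`. -/
def nearFormula : ℕ → {n : ℕ} → Fin n → Fin n → LD.BoundedFormula Empty n
  | 0, _, x, y => (&x) =' (&y)
  | r + 1, n, x, y => ∃' (nearFormula r x.castSucc (.last n) ⊓
      ((((&(.last n)) =' (&y.castSucc)) ⊔ dSym.boundedFormula₂ (&(.last n)) (&y.castSucc)) ⊔
        dSym.boundedFormula₂ (&y.castSucc) (&(.last n))))

variable {A B : Type*} [LD.Structure A] [LD.Structure B]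

theorem realize_nearFormula {n : ℕ} {i j : Fin n} {e : Empty → A} {v : Fin n → A} :
    (nearFormula r i j).Realize e v ↔ Near (toSimpleGraph A) r (v i) (v j) := by
  induction r generalizing n with
  | zero => simp [nearFormula]
  | succ r ih =>
    have adj_iff (z y : A) : (z = y ∨ (toSimpleGraph A).Adj z y) ↔
        (z = y ∨ Structure.RelMap dSym ![z, y]) ∨ Structure.RelMap dSym ![y, z] := by
      rw [toSimpleGraph, SimpleGraph.fromRel_adj]
      tauto
    simp [nearFormula, near_succ, adj_iff, ih, BoundedFormula.realize_rel₂]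

/-- The formula which says that the component of a point is contained in the ball of radius `r`
about that point. -/
def eccentLEFormula (r : ℕ) : LD.BoundedFormula Empty 1 :=
  ∀' (nearFormula (r + 1) (Fin.castSucc 0) (.last 1) ⟹ nearFormula r (Fin.castSucc 0) (.last 1))

theorem realize_eccentLEFormula {e : Empty → A} {v : Fin 1 → A} :
    (eccentLEFormula r).Realize e v ↔ EccentLE (toSimpleGraph A) r (v 0) := by
  simp only [eccentLEFormula, BoundedFormula.realize_all, BoundedFormula.realize_imp,
    realize_nearFormula, Fin.snoc_castSucc, Fin.snoc_last, eccentLE_iff]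

theorem eccentLE_map_iff (f : A ↪ₑ[LD] B) {x : A} :
    EccentLE (toSimpleGraph B) r (f x) ↔ EccentLE (toSimpleGraph A) r x := by
  have := f.map_boundedFormula (eccentLEFormula r) default fun _ => x
  rwa [realize_eccentLEFormula, realize_eccentLEFormula] at this

end Distance

section BackAndForth

variable {M : Type u} [LSet.Structure M]

variable (M) in
/-- The double-membership graph of `M`, as a graph on `M` itself. -/
abbrev dGraph : SimpleGraph M := toSimpleGraph (DGraph M)

theorem dGraph_adj_iff {x y : M} : (dGraph M).Adj x y ↔ x ≠ y ∧ DMem x y :=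
  (SimpleGraph.fromRel_adj _ _ _).trans (and_congr_right fun _ => or_iff_left_of_imp dMem_comm.1)

theorem near_dGraph_succ {r : ℕ} {x y : M} :
    Near (dGraph M) (r + 1) x y ↔ ∃ z, Near (dGraph M) r x z ∧ (z = y ∨ DMem z y) := by
  simp only [near_succ, dGraph_adj_iff]
  grind

instance Near.isDefinable₂ (r : ℕ) : IsDefinable₂ (Near (dGraph M) r) := by
  induction r with
  | zero => exact ⟨by simp only [near_zero]; infer_instance⟩
  | succ r ih => exact ⟨by simp only [near_dGraph_succ]; infer_instance⟩

/-- The pairs `x, x'` and `y, y'` satisfy the same atomic formulas of the SD-graph. -/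
structure SameType (x x' y y' : M) : Prop where
  eq_iff : x = x' ↔ y = y'
  sMem_iff : SMem x x' ↔ SMem y y'
  dMem_iff : DMem x x' ↔ DMem y y'

theorem SameType.swap {x x' y y' : M} (h : SameType x x' y y') : SameType x' x y' y where
  eq_iff := by rw [eq_comm, h.eq_iff, eq_comm]
  sMem_iff := by rw [sMem_comm, h.sMem_iff, sMem_comm]
  dMem_iff := by rw [dMem_comm, h.dMem_iff, dMem_comm]

/-- `R` is the graph of a definable isomorphism between two induced substructures of the
SD-graph. -/
structure IsPartialIso (R : M → M → Prop) : Prop where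
  isDefinable₂ : IsDefinable₂ R
  sameType {x x' y y'} : R x y → R x' y' → SameType x x' y y'

namespace IsPartialIso

variable {R R' : M → M → Prop}

theorem symm (hR : IsPartialIso R) : IsPartialIso fun x y => R y x where
  isDefinable₂ := have := hR.isDefinable₂; ⟨inferInstance⟩
  sameType h h' :=
    have := hR.sameType h h'
    ⟨this.eq_iff.symm, this.sMem_iff.symm, this.dMem_iff.symm⟩

theorem restrict (hR : IsPartialIso R) (A : M) : IsPartialIso fun x y => Mem x A ∧ R x y where
  isDefinable₂ := have := hR.isDefinable₂; ⟨inferInstance⟩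
  sameType h h' := hR.sameType h.2 h'.2

theorem or (hR : IsPartialIso R) (hR' : IsPartialIso R')
    (hcross : ∀ {x x' y y'}, R x y → R' x' y' → SameType x x' y y') :
    IsPartialIso fun x y => R x y ∨ R' x y where
  isDefinable₂ := have := hR.isDefinable₂; have := hR'.isDefinable₂; ⟨inferInstance⟩
  sameType := by
    rintro x x' y y' (h | h) (h' | h')
    exacts [hR.sameType h h', hcross h h', (hcross h' h).swap, hR'.sameType h h']

end IsPartialIso

/-- `R` is a partial isomorphism which maps `a` to `b`, and whose domain and range contain the
balls of radius `r` about `a` and `b`. -/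
structure IsLocalIso {ι : Type*} (r : ℕ) (a b : ι → M) (R : M → M → Prop) : Prop extends
    IsPartialIso R where
  apply : ∀ i, R (a i) (b i)
  exists_right {i x} : Near (dGraph M) r (a i) x → ∃ y, R x y
  exists_left {i y} : Near (dGraph M) r (b i) y → ∃ x, R x y

namespace IsLocalIso

variable {ι : Type*} {r s : ℕ} {R R' : M → M → Prop}

theorem refl (r : ℕ) (a : ι → M) : IsLocalIso r a a Eq where
  isDefinable₂ := ⟨inferInstance⟩
  sameType := by rintro _ _ _ _ rfl rfl; exact ⟨.rfl, .rfl, .rfl⟩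
  apply _ := rfl
  exists_right _ := ⟨_, rfl⟩
  exists_left _ := ⟨_, rfl⟩

variable {a b : ι → M}

theorem symm (h : IsLocalIso r a b R) : IsLocalIso r b a fun x y => R y x where
  toIsPartialIso := h.toIsPartialIso.symm
  apply := h.apply
  exists_right := h.exists_left
  exists_left := h.exists_right

theorem mono (h : IsLocalIso r a b R) (hs : s ≤ r) : IsLocalIso s a b R where
  toIsPartialIso := h.toIsPartialIso
  apply := h.apply
  exists_right h' := h.exists_right (h'.mono hs)
  exists_left h' := h.exists_left (h'.mono hs)

theorem near (h : IsLocalIso r a b R) (hs : s ≤ r) {i : ι} {x y : M}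
    (hx : Near (dGraph M) s (a i) x) (hxy : R x y) : Near (dGraph M) s (b i) y := by
  induction s generalizing x y with
  | zero => exact near_zero.2 ((h.sameType (h.apply i) hxy).eq_iff.1 (near_zero.1 hx))
  | succ s ih =>
    obtain ⟨z, hz, hzx⟩ := near_dGraph_succ.1 hx
    obtain ⟨w, hw⟩ := h.exists_right (hz.mono (by omega))
    have hzw := h.sameType hw hxy
    exact near_dGraph_succ.2 ⟨w, ih (by omega) hz hw, hzx.imp hzw.eq_iff.1 hzw.dMem_iff.1⟩

theorem of_le (h : IsLocalIso r a b R) (hR' : IsPartialIso R')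
    (hle : ∀ {i x y}, Near (dGraph M) r (a i) x → R x y → R' x y) : IsLocalIso r a b R' where
  toIsPartialIso := hR'
  apply i := hle (.refl r (a i)) (h.apply i)
  exists_right hx := (h.exists_right hx).imp fun _ => hle hx
  exists_left hy := (h.exists_left hy).imp fun _ hxy => hle (h.symm.near le_rfl hy hxy) hxy

theorem snoc {n : ℕ} {a b : Fin n → M} {c d : M} (h : IsLocalIso r a b R)
    (h' : IsLocalIso r (fun _ : Unit => c) (fun _ => d) R) :
    IsLocalIso r (Fin.snoc a c : Fin (n + 1) → M) (Fin.snoc b d : Fin (n + 1) → M) R where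
  toIsPartialIso := h.toIsPartialIso
  apply := Fin.lastCases (by simpa using h'.apply ()) fun i => by simpa using h.apply i
  exists_right {i x} := by
    induction i using Fin.lastCases with
    | last => simpa using h'.exists_right (i := ())
    | cast i => simpa using h.exists_right (i := i)
  exists_left {i x} := by
    induction i using Fin.lastCases with
    | last => simpa using h'.exists_left (i := ())
    | cast i => simpa using h.exists_left (i := i)

theorem of_near {t : ℕ} (h : IsLocalIso t a b R) {i : ι} {c d : M}
    (hc : Near (dGraph M) s (a i) c) (hcd : R c d) (hst : s + r ≤ t) :
    IsLocalIso r (fun _ : Unit => c) (fun _ => d) R where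
  toIsPartialIso := h.toIsPartialIso
  apply _ := hcd
  exists_right hx := h.exists_right ((hc.trans hx).mono hst)
  exists_left hy := h.exists_left (((h.near (by omega) hc hcd).trans hy).mono hst)

end IsLocalIso

namespace IsFreshCopy

variable {X T : M} {E Q : M → M → Prop} {F : M → M}

theorem exists_eq_of_reachable (h : IsFreshCopy X T E Q F) {x y : M} (hx : Mem x X)
    (hy : (dGraph M).Reachable (F x) y) : ∃ x', Mem x' X ∧ y = F x' := by
  rw [SimpleGraph.reachable_iff_reflTransGen] at hy
  induction hy with
  | refl => exact ⟨x, hx, rfl⟩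
  | tail _ hyz ih =>
    obtain ⟨x', hx', rfl⟩ := ih
    exact h.exists_eq_of_dMem hx' (dGraph_adj_iff.1 hyz).2

theorem isPartialIso (h : IsFreshCopy X T Mem Q F) : IsPartialIso (GraphOn X F) where
  isDefinable₂ := h.isDefinable₂
  sameType := by
    rintro x x' _ _ ⟨hx, rfl⟩ ⟨hx', rfl⟩
    have hxx' := h.mem_iff hx hx'
    have hx'x := h.mem_iff hx' hx
    exact ⟨⟨congrArg F, h.injOn hx hx'⟩, (or_congr hxx' hx'x).symm, (and_congr hxx' hx'x).symm⟩

theorem isLocalIso (h : IsFreshCopy X T Mem Q F) {r : ℕ} {c : M}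
    (hX : ∀ x, Mem x X ↔ Near (dGraph M) r c x) :
    IsLocalIso r (fun _ : Unit => c) (fun _ => F c) (GraphOn X F) where
  toIsPartialIso := h.isPartialIso
  apply _ := ⟨(hX c).2 (.refl r c), rfl⟩
  exists_right hx := ⟨_, (hX _).2 hx, rfl⟩
  exists_left hy := h.exists_eq_of_reachable ((hX c).2 (.refl r c)) hy.reachable

theorem eccentLE (h : IsFreshCopy X T Mem Q F) {r : ℕ} {c : M}
    (hX : ∀ x, Mem x X ↔ Near (dGraph M) r c x) : EccentLE (dGraph M) r (F c) := fun _ hy => by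
  obtain ⟨x, hx, rfl⟩ := h.exists_eq_of_reachable ((hX c).2 (.refl r c)) hy
  exact (h.isLocalIso hX).near (i := ()) le_rfl ((hX x).1 hx) ⟨hx, rfl⟩

theorem sameType {A : M} {R : M → M → Prop} (hR : IsPartialIso R)
    (h : IsFreshCopy X T Mem (fun t x => ∃ x', Mem x' A ∧ SMem x' x ∧ R x' t) F)
    (hRT : ∀ x y, Mem x A → R x y → Mem y T)
    (hAX : ∀ x x', Mem x A → Mem x' X → x ≠ x' ∧ ¬DMem x x') {x x' y : M}
    (hx : Mem x A) (hxy : R x y) (hx' : Mem x' X) : SameType x x' y (F x') := by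
  obtain ⟨hne, hD⟩ := hAX x x' hx hx'
  have hyT := hRT x y hx hxy
  have hFy := h.notMem_of_mem hx' hyT
  refine ⟨iff_of_false hne fun e => h.notMem hx' (e ▸ hyT), ?_,
    iff_of_false hD fun hD => hFy hD.2⟩
  rw [SMem, SMem, or_iff_left hFy, h.mem_iff_of_mem hx' hyT]
  constructor
  · exact fun hS => ⟨x, hx, hS, hxy⟩
  · rintro ⟨x₁, -, hS, hx₁⟩
    rwa [(hR.sameType hx₁ hxy).eq_iff.2 rfl] at hS

end IsFreshCopy

variable [hM : M ⊨ ZAFA₁]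

theorem isSmall_near (r : ℕ) (c : M) : IsSmall (Near (dGraph M) r c) := by
  have : ∀ r, IsDefinable₁ (Near (dGraph M) r c) := fun r => inferInstance
  induction r with
  | zero => exact (isSmall_eq c).mono fun x hx => (near_zero.1 hx).symm
  | succ r ih =>
    refine (ih.or ih.sUnion).mono fun x hx => ?_
    obtain ⟨z, hz, rfl | hzx⟩ := near_dGraph_succ.1 hx
    exacts [.inl hz, .inr ⟨z, hzx.2, hz⟩]

variable {n r : ℕ} {a b : Fin n → M} {R : M → M → Prop}

theorem IsLocalIso.exists_snoc_of_not_near (h : IsLocalIso r a b R) {c : M}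
    (hc : ∀ i, ¬Near (dGraph M) (2 * r + 1) (a i) c) :
    ∃ d, EccentLE (dGraph M) r d ∧ ∃ R',
      IsLocalIso r (Fin.snoc a c : Fin (n + 1) → M) (Fin.snoc b d : Fin (n + 1) → M) R' := by
  obtain ⟨A, hA⟩ := IsSmall.finite_ex fun i => isSmall_near r (a i)
  obtain ⟨T, hT⟩ := IsSmall.finite_ex fun i => isSmall_near r (b i)
  obtain ⟨X, hX⟩ := isSmall_near r c
  have := h.isDefinable₂
  have : IsDefinable₂ fun t x => ∃ x', Mem x' A ∧ SMem x' x ∧ R x' t := ⟨inferInstance⟩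
  have : IsDefinable₂ (Mem (M := M)) := ⟨inferInstance⟩
  obtain ⟨F, hF⟩ := exists_isFreshCopy X T Mem fun t x => ∃ x', Mem x' A ∧ SMem x' x ∧ R x' t
  have hRT (x y) (hx : Mem x A) (hxy : R x y) : Mem y T := by
    obtain ⟨i, hi⟩ := (hA x).1 hx
    exact (hT y).2 ⟨i, h.near le_rfl hi hxy⟩
  have hAX (x x') (hx : Mem x A) (hx' : Mem x' X) : x ≠ x' ∧ ¬DMem x x' := by
    rw [← not_or]
    intro hxx'
    obtain ⟨i, hi⟩ := (hA x).1 hx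
    have hix' : Near (dGraph M) (r + 1) (a i) x' := near_dGraph_succ.2 ⟨x, hi, hxx'⟩
    exact hc i ((hix'.trans ((hX x').1 hx').symm).mono (by omega))
  have hiso := (h.restrict A).or hF.isPartialIso fun hxy hx' =>
    hx'.2 ▸ hF.sameType h.toIsPartialIso hRT hAX hxy.1 hxy.2 hx'.1
  exact ⟨F c, hF.eccentLE hX, _,
    (h.of_le hiso fun hx hxy => .inl ⟨(hA _).2 ⟨_, hx⟩, hxy⟩).snoc
      ((hF.isLocalIso hX).of_le hiso fun _ => .inr)⟩

theorem IsLocalIso.exists_snoc (h : IsLocalIso (3 * r + 1) a b R) (c : M) : ∃ d R',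
    IsLocalIso r (Fin.snoc a c : Fin (n + 1) → M) (Fin.snoc b d : Fin (n + 1) → M) R' := by
  by_cases hc : ∃ i, Near (dGraph M) (2 * r + 1) (a i) c
  · obtain ⟨i, hi⟩ := hc
    obtain ⟨d, hd⟩ := h.exists_right (hi.mono (by omega))
    exact ⟨d, R, (h.mono (by omega)).snoc (h.of_near hi hd (by omega))⟩
  · obtain ⟨d, -, hd⟩ := (h.mono (by omega : r ≤ _)).exists_snoc_of_not_near (not_exists.1 hc)
    exact ⟨d, hd⟩

end BackAndForth

section InfiniteComponent

variable {M : Type u} [LSet.Structure M]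

/-- `g n` is the von Neumann numeral `n` of `M`. -/
structure IsNumeralSeq (g : ℕ → M) : Prop where
  zero : ∀ z, ¬Mem z (g 0)
  succ : ∀ n, IsSucc (g (n + 1)) (g n)

namespace IsNumeralSeq

variable {g : ℕ → M} {m n : ℕ} {z : M}

theorem mem_iff (hg : IsNumeralSeq g) : Mem z (g n) ↔ ∃ m < n, z = g m := by
  induction n with
  | zero => simp [hg.zero]
  | succ n ih =>
    simp only [hg.succ n z, ih, Nat.lt_succ_iff_lt_or_eq, or_and_right, exists_or, exists_eq_left]

theorem notMem_self (hg : IsNumeralSeq g) (n : ℕ) : ¬Mem (g n) (g n) := by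
  induction n using Nat.strong_induction_on with
  | _ n ih =>
    intro h
    obtain ⟨m, hm, hmn⟩ := hg.mem_iff.1 h
    exact ih m hm (hmn ▸ h)

theorem injective (hg : IsNumeralSeq g) : Function.Injective g :=
  .of_lt_imp_ne fun m n hmn h => hg.notMem_self n (hg.mem_iff.2 ⟨m, hmn, h.symm⟩)

theorem mem_iff_lt (hg : IsNumeralSeq g) : Mem (g m) (g n) ↔ m < n := by
  simp [hg.mem_iff, hg.injective.eq_iff]

theorem eq_of_isSucc (hg : IsNumeralSeq g) (h : IsSucc (g n) z) : ∃ m, n = m + 1 ∧ z = g m := by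
  obtain ⟨m, hm, rfl⟩ := hg.mem_iff.1 ((h z).2 (.inr rfl))
  refine ⟨m, le_antisymm (not_lt.1 fun hlt => ?_) hm, rfl⟩
  have := (h (g (m + 1))).1 (hg.mem_iff_lt.2 hlt)
  simp [hg.mem_iff_lt, hg.injective.eq_iff] at this

end IsNumeralSeq

theorem IsFreshCopy.near_numeral {X T : M} {Q : M → M → Prop} {F : M → M} {g : ℕ → M}
    (h : IsFreshCopy X T (fun x y => IsSucc x y ∨ IsSucc y x) Q F)
    (hg : IsNumeralSeq g) (hgX : ∀ n, Mem (g n) X) (n : ℕ) :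
    Near (dGraph M) n (F (g 0)) (F (g n)) := by
  induction n with
  | zero => exact .refl 0 _
  | succ n ih =>
    exact near_dGraph_succ.2 ⟨_, ih, .inr ⟨(h.mem_iff (hgX _) (hgX _)).2 (.inr (hg.succ n)),
      (h.mem_iff (hgX _) (hgX _)).2 (.inl (hg.succ n))⟩⟩

variable [hM : M ⊨ ZAFA₁]

variable (M) in
theorem exists_isNumeralSeq : ∃ (I : M) (g : ℕ → M), IsNumeralSeq g ∧ ∀ n, Mem (g n) I := by
  obtain ⟨I, ⟨e, he, heI⟩, hI⟩ := exists_inductive (M := M)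
  choose f hf hfI using fun x : {x // Mem x I} => hI x x.2
  let g : ℕ → {x // Mem x I} := fun n => n.rec ⟨e, heI⟩ fun _ x => ⟨f x, hfI x⟩
  exact ⟨I, fun n => (g n).1, ⟨he, fun n => hf (g n)⟩, fun n => (g n).2⟩

variable (M) in
theorem infinite_of_models_ZAFA₁ : Infinite M := by
  obtain ⟨-, g, hg, -⟩ := exists_isNumeralSeq M
  exact .of_injective g hg.injective

theorem IsFreshCopy.exists_eq_numeral_of_near {X T : M} {Q : M → M → Prop} {F : M → M} {g : ℕ → M}
    (h : IsFreshCopy X T (fun x y => IsSucc x y ∨ IsSucc y x) Q F)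
    (hg : IsNumeralSeq g) (hgX : ∀ n, Mem (g n) X) {r : ℕ} {y : M}
    (hy : Near (dGraph M) r (F (g 0)) y) : ∃ m ≤ r, y = F (g m) := by
  induction r generalizing y with
  | zero => exact ⟨0, le_rfl, (near_zero.1 hy).symm⟩
  | succ r ih =>
    obtain ⟨z, hz, hzy⟩ := near_dGraph_succ.1 hy
    obtain ⟨m, hm, rfl⟩ := ih hz
    rcases hzy with rfl | hzy
    · exact ⟨m, by omega, rfl⟩
    obtain ⟨x, hx, rfl⟩ := h.exists_eq_of_dMem (hgX m) hzy
    rcases (h.mem_iff (hgX m) hx).1 hzy.1 with hmx | hxm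
    · obtain ⟨k, rfl, rfl⟩ := hg.eq_of_isSucc hmx
      exact ⟨k, by omega, rfl⟩
    · have hx : x = g (m + 1) := eq_of_forall_mem_iff fun z => (hxm z).trans (hg.succ m z).symm
      exact ⟨m + 1, by omega, congrArg F hx⟩

/-- A fresh copy of the successor graph of the numerals contains a component which is a ray. -/
theorem exists_not_eccentLE : ∃ x : M, ∀ r, ¬EccentLE (dGraph M) r x := by
  obtain ⟨I, g, hg, hgI⟩ := exists_isNumeralSeq M
  have : IsDefinable₂ fun x y : M => IsSucc x y ∨ IsSucc y x :=
    ⟨by unfold IsSucc; infer_instance⟩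
  have : IsDefinable₂ fun _ _ : M => False := ⟨inferInstance⟩
  obtain ⟨F, hF⟩ := exists_isFreshCopy I I (fun x y => IsSucc x y ∨ IsSucc y x) fun _ _ => False
  refine ⟨F (g 0), fun r hr => ?_⟩
  have hnear := hr _ (hF.near_numeral hg hgI (r + 1)).reachable
  obtain ⟨m, hm, heq⟩ := hF.exists_eq_numeral_of_near hg hgI hnear
  have := hg.injective (hF.injOn (hgI _) (hgI _) heq)
  omega

theorem hasComponentOfInfiniteDiameter_dGraph : HasComponentOfInfiniteDiameter (DGraph M) := by
  obtain ⟨x, hx⟩ := exists_not_eccentLE (M := M)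
  exact ⟨_, ediam_toSimpleGraph_eq_top hx⟩

end InfiniteComponent

section ElementarySubstructure

variable {M : Type u} [LSet.Structure M] {R : M → M → Prop}

theorem IsPartialIso.relMap_iff (hR : IsPartialIso R) {k : ℕ} (P : LSD.Relations k)
    {x y : Fin k → M} (h : ∀ i, R (x i) (y i)) :
    Structure.RelMap (M := SDGraph M) P x ↔ Structure.RelMap (M := SDGraph M) P y := by
  cases P
  exacts [(hR.sameType (h 0) (h 1)).sMem_iff, (hR.sameType (h 0) (h 1)).dMem_iff]

theorem IsLocalIso.realize_term {n r : ℕ} {a b : Fin n → M} (h : IsLocalIso r a b R)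
    (t : LSD.Term (Empty ⊕ Fin n)) :
    R (t.realize (M := SDGraph M) (Sum.elim default a))
      (t.realize (M := SDGraph M) (Sum.elim default b)) := by
  rcases t with (i | i) | f
  exacts [i.elim, h.apply i, Empty.elim f]

variable (M) in
/-- The points of the SD-graph whose components in the D-graph have finite diameter. -/
def boundedPart : LSD.Substructure (SDGraph M) where
  carrier := {x | ∃ r, EccentLE (dGraph M) r x}
  fun_mem f := Empty.elim f

variable [hM : M ⊨ ZAFA₁]

theorem exists_radius {n : ℕ} (φ : LSD.BoundedFormula Empty n) :
    ∃ r, ∀ (a b : Fin n → M) (R : M → M → Prop), IsLocalIso r a b R →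
      (φ.Realize (M := SDGraph M) default a ↔ φ.Realize (M := SDGraph M) default b) := by
  induction φ with
  | falsum => exact ⟨0, fun _ _ _ _ => .rfl⟩
  | equal t t' =>
    exact ⟨0, fun _ _ _ h => (h.sameType (h.realize_term t) (h.realize_term t')).eq_iff⟩
  | rel P ts => exact ⟨0, fun _ _ _ h => h.relMap_iff P fun i => h.realize_term (ts i)⟩
  | imp φ ψ ihφ ihψ =>
    obtain ⟨r, hr⟩ := ihφ
    obtain ⟨s, hs⟩ := ihψ
    exact ⟨max r s, fun a b R h => imp_congr (hr a b R (h.mono (le_max_left r s)))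
      (hs a b R (h.mono (le_max_right r s)))⟩
  | all φ ih =>
    obtain ⟨r, hr⟩ := ih
    refine ⟨3 * r + 1, fun a b R h => ⟨fun hφ d => ?_, fun hφ c => ?_⟩⟩
    · obtain ⟨c, R', h'⟩ := h.symm.exists_snoc d
      exact (hr _ _ _ h').2 (hφ c)
    · obtain ⟨d, R', h'⟩ := h.exists_snoc c
      exact (hr _ _ _ h').2 (hφ d)

theorem boundedPart_isElementary : (boundedPart M).IsElementary := by
  refine Substructure.isElementary_of_exists _ fun n φ x c hc => ?_
  by_cases hcN : c ∈ boundedPart M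
  · exact ⟨⟨c, hcN⟩, hc⟩
  obtain ⟨r, hr⟩ := exists_radius (M := M) φ
  let x' : Fin n → M := fun i => (x i).1
  obtain ⟨d, hd, R, hR⟩ := (IsLocalIso.refl r x').exists_snoc_of_not_near (c := c) fun i hi => by
    obtain ⟨s, hs⟩ := (x i).2
    exact hcN ⟨_, hs.of_near hi⟩
  exact ⟨⟨d, r, hd⟩, (hr _ _ R hR).1 hc⟩

end ElementarySubstructure

section CountableModel

theorem card_LSD_le_aleph0 : LSD.card ≤ Cardinal.aleph0 := by
  have : ∀ n, Countable (LSD.Functions n) := fun _ => inferInstanceAs (Countable Empty)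
  have : ∀ n, Countable (LSD.Relations n) := fun n =>
    ⟨fun P : SDRel n => match P with
      | SDRel.S => 0
      | SDRel.D => 1, fun P P' h => by cases P <;> cases P' <;> first | rfl | simp at h⟩
  exact Cardinal.mk_le_aleph0_iff.2 (inferInstanceAs (Countable ((Σ _, _) ⊕ (Σ _, _))))

theorem exists_countable_elementaryEmbedding (M : Type u) [LSet.Structure M] [hM : M ⊨ ZAFA₁] :
    ∃ (N : Type) (_ : LSD.Structure N), Countable N ∧
      ∃ f : N ↪ₑ[LSD] SDGraph M, ∀ x, ∃ r, EccentLE (dGraph M) r (f x) := by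
  let S : LSD.ElementarySubstructure (SDGraph M) := ⟨boundedPart M, boundedPart_isElementary⟩
  have : Infinite (SDGraph M) := infinite_of_models_ZAFA₁ M
  have : Infinite S := S.elementarilyEquivalent.symm.infinite
  obtain ⟨N, ⟨f⟩, hN⟩ := exists_elementaryEmbedding_card_eq_of_le LSD S Cardinal.aleph0.{0} le_rfl
    (by simpa using card_LSD_le_aleph0) (by simp)
  exact ⟨N, inferInstance, Cardinal.mk_le_aleph0_iff.1 hN.le, S.subtype.comp f, fun x => (f x).2⟩

end CountableModel

section Reduct

/-- An elementary embedding for a language `L'`, as one for a language `L` interpreted in `L'`. -/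
def reductElementaryEmbedding {L L' : FirstOrder.Language} (φ : L →ᴸ L') {A B : Type*}
    [L.Structure A] [L'.Structure A] [φ.IsExpansionOn A] [L.Structure B] [L'.Structure B]
    [φ.IsExpansionOn B] (f : A ↪ₑ[L'] B) : A ↪ₑ[L] B where
  toFun := f
  map_formula' n ψ x := by
    rw [← φ.realize_onFormula, ← φ.realize_onFormula]
    exact f.map_formula (φ.onFormula ψ) x

/-- The inclusion of the language `{D}` in the language `{S, D}`. -/
def dToSD : LD →ᴸ LSD where
  onFunction {_} f := Empty.elim f
  onRelation {_} R := match R with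
    | DRel.D => SDRel.D

instance (M : Type*) [LSet.Structure M] : LSD.Structure (DGraph M) :=
  inferInstanceAs (LSD.Structure (SDGraph M))

instance (M : Type*) [LSet.Structure M] : dToSD.IsExpansionOn (DGraph M) where
  map_onFunction f := Empty.elim f
  map_onRelation R _ := by cases R; rfl

theorem not_surjective_of_forall_exists_eccentLE {N K : Type*} [LD.Structure N]
    [LSet.Structure K] [hK : K ⊨ ZAFA₁] (hN : ∀ x : N, ∃ r, EccentLE (toSimpleGraph N) r x)
    (f : N ↪ₑ[LD] DGraph K) : ¬Function.Surjective f := fun hf => by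
  obtain ⟨y, hy⟩ := exists_not_eccentLE (M := K)
  obtain ⟨x, rfl⟩ := hf y
  obtain ⟨r, hr⟩ := hN x
  exact hy r ((eccentLE_map_iff f).2 hr)

end Reduct

end AntiFoundation

open AntiFoundation FirstOrder.Language in
theorem mainTheorem4_general (M : Type u) [LSet.Structure M] (hM : M ⊨ ZAFA₁) :
    (∃ (N : Type) (_ : LSD.Structure N), Countable N ∧ (N ≅[LSD] SDGraph M) ∧
      ∀ (K : Type v) [LSet.Structure K], K ⊨ ZAFA₁ → IsEmpty (N ≃[LSD] SDGraph K)) ∧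
    (∃ (N' : Type) (_ : LD.Structure N'), Countable N' ∧ (N' ≅[LD] DGraph M) ∧
      ∀ (K : Type v) [LSet.Structure K], K ⊨ ZAFA₁ → IsEmpty (N' ≃[LD] DGraph K)) ∧
    HasComponentOfInfiniteDiameter (DGraph M) := by
  obtain ⟨N, instN, hN, f, hf⟩ := exists_countable_elementaryEmbedding M
  let instN' := dToSD.reduct N
  let f' : N ↪ₑ[LD] DGraph M := reductElementaryEmbedding dToSD (B := DGraph M) f
  have hN' : ∀ x : N, ∃ r, EccentLE (toSimpleGraph N) r x := fun x =>
    (hf x).imp fun _ => (eccentLE_map_iff f').1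
  refine ⟨⟨N, instN, hN, f.elementarilyEquivalent, fun K _ hK => ⟨fun g => ?_⟩⟩,
    ⟨N, instN', hN, f'.elementarilyEquivalent, fun K _ hK => ⟨fun g => ?_⟩⟩,
    hasComponentOfInfiniteDiameter_dGraph⟩
  · exact not_surjective_of_forall_exists_eccentLE hN'
      (reductElementaryEmbedding dToSD (B := DGraph K) g.toElementaryEmbedding) g.surjective
  · exact not_surjective_of_forall_exists_eccentLE hN' g.toElementaryEmbedding g.surjective

theorem mainTheorem4 (M : Type u) [AntiFoundation.LSet.Structure M]
    (hM : M ⊨ AntiFoundation.ZFA) :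
    (∃ (N : Type) (_ : AntiFoundation.LSD.Structure N),
      Countable N ∧ (N ≅[AntiFoundation.LSD] AntiFoundation.SDGraph M) ∧
      ∀ (K : Type v) [AntiFoundation.LSet.Structure K], K ⊨ AntiFoundation.ZFA →
        IsEmpty (N ≃[AntiFoundation.LSD] AntiFoundation.SDGraph K)) ∧
    (∃ (N' : Type) (_ : AntiFoundation.LD.Structure N'),
      Countable N' ∧ (N' ≅[AntiFoundation.LD] AntiFoundation.DGraph M) ∧
      ∀ (K : Type v) [AntiFoundation.LSet.Structure K], K ⊨ AntiFoundation.ZFA →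
        IsEmpty (N' ≃[AntiFoundation.LD] AntiFoundation.DGraph K)) ∧
    AntiFoundation.HasComponentOfInfiniteDiameter (AntiFoundation.DGraph M) := by
  obtain ⟨⟨N, _, hN, hNM, hNK⟩, ⟨N', _, hN', hNM', hNK'⟩, hdiam⟩ :=
    mainTheorem4_general.{u, v} M (AntiFoundation.models_ZAFA₁_of_models_ZFA hM)
  exact ⟨⟨N, _, hN, hNM, fun K _ hK => hNK K (AntiFoundation.models_ZAFA₁_of_models_ZFA hK)⟩,
    ⟨N', _, hN', hNM', fun K _ hK => hNK' K (AntiFoundation.models_ZAFA₁_of_models_ZFA hK)⟩, hdiam⟩
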